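/- **Setting.** Let $(\Omega,\mathcal F,\mathbb P)$ be a probability space, $\alpha\in(0,1)$, and let $\lambda:[0,\infty)\to(0,\infty)$ be locally integrable with $\Lambda(t):=\int_0^t\lambda(\tau)\,d\tau\to\infty$ as $t\to\infty$. Let $N_1$ be a Poisson process with parameter $1$ and put $N(t):=N_1(\Lambda(t))$. Let $L_\alpha$ be an $\alpha$-stable subordinator, i.e. a nondecreasing Lévy process with $\mathbb E[e^{-uL_\alpha(t)}]=e^{-tu^\alpha}$ for $u,t\ge 0$, and let $Y_\alpha(t):=\inf\{u\ge 0: L_\alpha(u)>t\}$ be its inverse. Assume that the process $Y_\alpha$ is independent of the process $N$. The fractional non-homogeneous Poisson process (FNPP) is $$N_\alpha(t):=N(Y_\alpha(t))=N_1(\Lambda(Y_\alpha(t))),\qquad t\ge 0.$$ Put $\mathcal F_0^{Y}:=\sigma(Y_\alpha(t),\,t\ge 0)$ (the non-trivial initial history) and $\mathcal F_t:=\mathcal F_0^{Y}\vee\sigma(N_\alpha(s),\,s\le t)$ for $t\ge 0$. **Definition.** Let $M$ be a point process on $[0,\infty)$, described by its counting process (almost surely $M(0)=0$ and the path is nondecreasing,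 right-continuous, with values in $\{0,1,2,\dots\}$), and let $A$ be a $[0,\infty)$-valued process whose paths are almost surely right-continuous and nondecreasing. For a $\sigma$-algebra $\mathcal G\subseteq\mathcal F$ and $r\ge 0$, say that $M$ is, conditionally on $\mathcal G$, a Poisson process with intensity $dA$ from time $r$ on, if for all $r\le s\le t$ and all $k\in\{0,1,2,\dots\}$, almost surely, $$\mathbb P\big(M(t)-M(s)=k\,\big|\,\mathcal G\big)=e^{-(A(t)-A(s))}\,\frac{(A(t)-A(s))^k}{k!},$$ and for all $r\le t_0\le t_1\le\dots\le t_n$ the increments $M(t_1)-M(t_0),\dots,M(t_n)-M(t_{n-1})$ are conditionally independent given $\mathcal G$. For a filtration $(\mathcal H_t)_{t\ge0}$, $M$ is an $(\mathcal H_t)$-Cox process directed by $A$ if $M$ is adapted to $(\mathcal H_t)$, $\mathcal H_t=\sigma(A(s),\,s\ge0)\vee\sigma(M(s),\,s\le t)$ for every $t\ge 0$, and $M$ is a Poisson process with intensity $dA$ conditionally on $\sigma(A(s),\,s\ge 0)$ from time $0$ on, and conditionally on $\mathcal H_r$ from time $r$ on, for every $r\ge 0$. **Proposition (the FNPP is a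 Cox process).** With respect to the filtration $(\mathcal F_t)_{t\ge0}$ with non-trivial initial history $\mathcal F_0^{Y}$, the FNPP $(N_\alpha(t))_{t\ge0}$ is an $(\mathcal F_t)$-Cox process directed by $(\Lambda(Y_\alpha(t)))_{t\ge 0}$. In particular, for all $s\le t$, conditionally on $\mathcal F_s$ the increment $N_\alpha(t)-N_\alpha(s)$ is Poisson distributed with mean $\Lambda(Y_\alpha(t))-\Lambda(Y_\alpha(s))$, and the increments of $N_\alpha$ after time $s$ are conditionally independent given $\mathcal F_s$. -/

import Mathlib

open MeasureTheory ProbabilityTheory Filter Set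
open scoped NNReal ENNReal Topology

noncomputable section

namespace FNPP

variable {Ω : Type*} {m : MeasurableSpace Ω}

/-- Right-continuity of a path indexed by `[0, ∞)`. -/
def IsRightCts {E : Type*} [TopologicalSpace E] (f : ℝ≥0 → E) : Prop :=
  ∀ t, ContinuousWithinAt f (Ici t) t

/-- Paths that are right-continuous with left limits. At `t = 0` the left limit is no condition,
as there is no earlier time. -/
def IsCadlagPath (f : ℝ≥0 → ℝ) : Prop :=
  IsRightCts f ∧ ∀ t, ∃ l, Tendsto f (𝓝[<] t) (𝓝 l)

/-- A (non-explosive) point process on `[0, ∞)`, given by its counting process: almost every path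
starts at `0`, is nondecreasing and is right-continuous with values in `ℕ`. -/
structure IsPointProcess (N : ℝ≥0 → Ω → ℕ) (μ : Measure Ω) : Prop where
  measurable : ∀ t, Measurable (N t)
  paths : ∀ᵐ ω ∂μ, N 0 ω = 0 ∧ Monotone (fun t ↦ N t ω) ∧ IsRightCts (fun t ↦ N t ω)

/-- A homogeneous Poisson process with parameter `r`: a point process with independent increments
for which `N t - N s` is Poisson distributed with mean `r (t - s)`. -/
structure IsPoissonProcess (N : ℝ≥0 → Ω → ℕ) (r : ℝ≥0) (μ : Measure Ω) : Prop where
  isPointProcess : IsPointProcess N μ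
  indep : HasIndepIncrements N μ
  law : ∀ s t, s ≤ t → HasLaw (fun ω ↦ N t ω - N s ω) (poissonMeasure (r * (t - s))) μ

/-- A real Lévy process: it starts at `0`, has independent and stationary increments, and almost
all of its paths are càdlàg. -/
structure IsLevyProcess (L : ℝ≥0 → Ω → ℝ) (μ : Measure Ω) : Prop where
  measurable : ∀ t, Measurable (L t)
  zero : ∀ᵐ ω ∂μ, L 0 ω = 0
  indep : HasIndepIncrements L μ
  stationary : ∀ s t, IdentDistrib (fun ω ↦ L (s + t) ω - L s ω) (L t) μ μ
  paths : ∀ᵐ ω ∂μ, IsCadlagPath (fun t ↦ L t ω)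

/-- The `α`-stable subordinator: a nondecreasing Lévy process with Laplace transform
`E[exp (-u L t)] = exp (-t u ^ α)`. -/
structure IsStableSubordinator (α : ℝ) (L : ℝ≥0 → Ω → ℝ) (μ : Measure Ω) : Prop where
  isLevyProcess : IsLevyProcess L μ
  monotone : ∀ᵐ ω ∂μ, Monotone (fun t ↦ L t ω)
  laplace : ∀ (t u : ℝ≥0), Integrable (fun ω ↦ Real.exp (-(u * L t ω))) μ ∧
    ∫ ω, Real.exp (-(u * L t ω)) ∂μ = Real.exp (-(t * (u : ℝ) ^ α))

/-- The inverse `Y t = inf {u ≥ 0 | L u > t}`. (The set is non-empty almost surely when `L` is a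
stable subordinator; on the exceptional event the value is `0`.) -/
def inverseProcess (L : ℝ≥0 → Ω → ℝ) (t : ℝ≥0) (ω : Ω) : ℝ≥0 :=
  sInf {u : ℝ≥0 | (t : ℝ) < L u ω}

/-- The cumulative rate `Λ t = ∫₀ᵗ lam`, for a rate function that is positive on `[0, ∞)`, as an
element of `[0, ∞)`. -/
def cumulativeRate (lam : ℝ → ℝ) (t : ℝ≥0) : ℝ≥0 :=
  Real.toNNReal (∫ τ in (0 : ℝ)..t, lam τ)

/-- The non-homogeneous Poisson process `N t = N₁ (Λ t)`. -/
def nonhomogeneous (lam : ℝ → ℝ) (N₁ : ℝ≥0 → Ω → ℕ) (t : ℝ≥0) (ω : Ω) : ℕ :=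
  N₁ (cumulativeRate lam t) ω

/-- The fractional non-homogeneous Poisson process `N_α t = N (Y_α t) = N₁ (Λ (Y_α t))`. -/
def fractional (lam : ℝ → ℝ) (N₁ : ℝ≥0 → Ω → ℕ) (L : ℝ≥0 → Ω → ℝ) (t : ℝ≥0) (ω : Ω) : ℕ :=
  nonhomogeneous lam N₁ (inverseProcess L t ω) ω

/-- The σ-algebra `σ(Z t, t ≥ 0)` generated by a whole process. -/
abbrev wholeHistory (Z : ℝ≥0 → Ω → ℝ≥0) : MeasurableSpace Ω :=
  ⨆ t, MeasurableSpace.comap (Z t) inferInstance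

/-- The σ-algebra `σ(N s, s ≤ t)`. -/
abbrev pastHistory (N : ℝ≥0 → Ω → ℕ) (t : ℝ≥0) : MeasurableSpace Ω :=
  ⨆ s, ⨆ _ : s ≤ t, MeasurableSpace.comap (N s) inferInstance

/-- The intrinsic history `F t = σ(Z s, s ≥ 0) ∨ σ(N s, s ≤ t)` with initial history generated by
the process `Z`. -/
def intrinsicHistory (Z : ℝ≥0 → Ω → ℝ≥0) (N : ℝ≥0 → Ω → ℕ)
    (hZ : ∀ t, Measurable (Z t)) (hN : ∀ t, Measurable (N t)) : Filtration ℝ≥0 m where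
  seq t := wholeHistory Z ⊔ pastHistory N t
  mono' _ _ hst :=
    sup_le_sup le_rfl (iSup_mono fun _ ↦ iSup_mono' fun h ↦ ⟨h.trans hst, le_rfl⟩)
  le' _ := sup_le (iSup_le fun t ↦ (hZ t).comap_le)
    (iSup_le fun s ↦ iSup_le fun _ ↦ (hN s).comap_le)

/-- Conditionally on the σ-algebra `G`, the process `N` is from time `r` on a Poisson process with
intensity `dA`: its increments after `r` are conditionally Poisson with mean `A t - A s`, and
conditionally independent over successive time intervals. -/
structure IsConditionallyPoisson {S : Type*} (G : MeasurableSpace S) {mS : MeasurableSpace S}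
    (r : ℝ≥0) (N : ℝ≥0 → S → ℕ) (A : ℝ≥0 → S → ℝ≥0) (μ : Measure S) : Prop where
  law : ∀ s t, r ≤ s → s ≤ t → ∀ k : ℕ,
    μ⟦{ω | N t ω - N s ω = k} | G⟧ =ᵐ[μ] fun ω ↦ (poissonMeasure (A t ω - A s ω)).real {k}
  indep : ∀ (n : ℕ) (t : Fin (n + 1) → ℝ≥0), r ≤ t 0 → Monotone t → ∀ k : Fin n → ℕ,
    μ⟦{ω | ∀ i : Fin n, N (t i.succ) ω - N (t i.castSucc) ω = k i} | G⟧ =ᵐ[μ]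
      fun ω ↦ ∏ i : Fin n, (μ⟦{ω' | N (t i.succ) ω' - N (t i.castSucc) ω' = k i} | G⟧) ω

/-- `N` is an `F`-Cox process directed by `A`: `N` is an adapted point process, `A` is
right-continuous and nondecreasing, `F t = F₀ ∨ σ(N s, s ≤ t)` with `F₀ = σ(A s, s ≥ 0)`, and
conditionally on this history (on `F₀`, and on `F r` for the increments after time `r`) `N` is a
Poisson process with intensity `dA`. -/
structure IsCoxProcess (F : Filtration ℝ≥0 m) (N : ℝ≥0 → Ω → ℕ) (A : ℝ≥0 → Ω → ℝ≥0)
    (μ : Measure Ω) : Prop where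
  isPointProcess : IsPointProcess N μ
  adapted : ∀ t, Measurable[F t] (N t)
  directing : ∀ᵐ ω ∂μ, Monotone (fun t ↦ A t ω) ∧ IsRightCts (fun t ↦ A t ω)
  history : ∀ t, F t = wholeHistory A ⊔ pastHistory N t
  poisson_initial : IsConditionallyPoisson (wholeHistory A) 0 N A μ
  poisson : ∀ r, IsConditionallyPoisson (F r) r N A μ

end FNPP

end

/-! Freeze the clock. Since `Y` is independent of `N`, conditioning on a path `y` of `Y` turns `N ∘
Y` into `N ∘ y`, whose increments are Poisson with means given by `Λ ∘ y` and independent of its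
past. Integrating over `y` gives, for each event `{Y ∈ C}` intersected with finitely many conditions
on the values of `N ∘ Y` up to time `r`, the joint law of the increments after `r`
(`measure_timeChange_inter`). These events form a π-system generating the history at `r`, so the
product of Poisson weights is the conditional probability (`condExp_increments_timeChange`). The
joint formula yields both the law and the conditional independence (`of_joint`). Conditioning on the
clock alone follows by the tower property. The clock and `Λ ∘ Y` generate the same σ-algebra because
`Λ` is continuous and injective. -/

namespace FNPP

/-! ### The cumulative rate is continuous and strictly increasing. -/

section CumulativeRate

variable {lam : ℝ → ℝ}

lemma intervalIntegrable_of_locallyIntegrableOn_Ici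
    (h : LocallyIntegrableOn lam (Ici 0) volume) {a b : ℝ} (ha : 0 ≤ a) (hb : 0 ≤ b) :
    IntervalIntegrable lam volume a b := by
  rw [intervalIntegrable_iff']
  refine h.integrableOn_compact_subset (fun x hx ↦ ?_) isCompact_uIcc
  exact (le_min ha hb).trans hx.1

lemma cumulativeRate_zero : cumulativeRate lam 0 = 0 := by
  simp [cumulativeRate]

lemma integral_strictMono (hpos : ∀ τ : ℝ, 0 ≤ τ → 0 < lam τ)
    (h : LocallyIntegrableOn lam (Ici 0) volume) :
    StrictMono fun t : ℝ≥0 ↦ ∫ τ in (0 : ℝ)..t, lam τ := by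
  intro s t hst
  have h1 : (∫ τ in (0 : ℝ)..s, lam τ) + (∫ τ in (s : ℝ)..t, lam τ) = ∫ τ in (0 : ℝ)..t, lam τ :=
    intervalIntegral.integral_add_adjacent_intervals
    (intervalIntegrable_of_locallyIntegrableOn_Ici h le_rfl s.2)
    (intervalIntegrable_of_locallyIntegrableOn_Ici h s.2 t.2)
  have h2 : 0 < ∫ τ in (s : ℝ)..t, lam τ :=
    intervalIntegral.intervalIntegral_pos_of_pos_on
      (intervalIntegrable_of_locallyIntegrableOn_Ici h s.2 t.2)
      (fun x hx ↦ hpos x (s.2.trans hx.1.le)) hst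
  change ∫ τ in (0 : ℝ)..s, lam τ < ∫ τ in (0 : ℝ)..t, lam τ
  linarith

lemma cumulativeRate_strictMono (hpos : ∀ τ : ℝ, 0 ≤ τ → 0 < lam τ)
    (h : LocallyIntegrableOn lam (Ici 0) volume) : StrictMono (cumulativeRate lam) := by
  intro s t hst
  have hmono := integral_strictMono hpos h
  have h0 : ∫ τ in (0 : ℝ)..((0 : ℝ≥0) : ℝ), lam τ ≤ ∫ τ in (0 : ℝ)..s, lam τ :=
    hmono.monotone (zero_le (a := s))
  rw [NNReal.coe_zero, intervalIntegral.integral_same] at h0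
  exact (Real.toNNReal_lt_toNNReal_iff_of_nonneg h0).2 (hmono hst)

lemma continuous_cumulativeRate (h : LocallyIntegrableOn lam (Ici 0) volume) :
    Continuous (cumulativeRate lam) := by
  refine continuous_real_toNNReal.comp (continuous_iff_continuousAt.2 fun t ↦ ?_)
  have h1 : ContinuousOn (fun x ↦ ∫ τ in (0 : ℝ)..x, lam τ) (uIcc 0 (t + 1 : ℝ)) := by
    refine intervalIntegral.continuousOn_primitive_interval ?_
    rw [← intervalIntegrable_iff']
    exact intervalIntegrable_of_locallyIntegrableOn_Ici h le_rfl (by positivity)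
  have h2 := (h1 t (by rw [uIcc_of_le (by positivity)]; exact ⟨t.2, by linarith⟩))
  refine ContinuousWithinAt.tendsto h2 |>.comp (tendsto_nhdsWithin_iff.2
    ⟨NNReal.continuous_coe.continuousAt, ?_⟩)
  filter_upwards [Iio_mem_nhds (show t < t + 1 by simp)] with s hs
  rw [uIcc_of_le (by positivity)]
  exact ⟨s.2, by exact_mod_cast le_of_lt hs⟩

end CumulativeRate

lemma IsRightCts.comp {E : Type*} [TopologicalSpace E] {f : ℝ≥0 → E} {g : ℝ≥0 → ℝ≥0}
    (hf : IsRightCts f) (hg : IsRightCts g) (hmono : Monotone g) :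
    IsRightCts fun t ↦ f (g t) :=
  fun t ↦ ContinuousWithinAt.comp (hf (g t)) (hg t) fun _ hs ↦ hmono hs

/-! ### Path properties of the inverse subordinator. -/

section Inverse

lemma monotone_sInf_lt {f : ℝ≥0 → ℝ} (hf : ∀ t : ℝ≥0, ∃ u, (t : ℝ) < f u) :
    Monotone fun t : ℝ≥0 ↦ sInf {u : ℝ≥0 | (t : ℝ) < f u} := fun _ t hst ↦
  csInf_le_csInf (OrderBot.bddBelow _) (hf t) fun _ hu ↦
    (NNReal.coe_le_coe.2 hst).trans_lt hu

/-- No regularity of `f` is needed: a level `u` with `t < f u` still satisfies `s < f u` for all `s`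
slightly above `t`, so the infimum cannot jump up to the right of `t`. -/
lemma isRightCts_sInf_lt {f : ℝ≥0 → ℝ} (hf : ∀ t : ℝ≥0, ∃ u, (t : ℝ) < f u) :
    IsRightCts fun t : ℝ≥0 ↦ sInf {u : ℝ≥0 | (t : ℝ) < f u} := by
  refine fun t ↦ tendsto_order.2 ⟨fun a ha ↦ ?_, fun b hb ↦ ?_⟩
  · filter_upwards [self_mem_nhdsWithin] with s hs
    exact ha.trans_le (monotone_sInf_lt hf hs)
  · obtain ⟨u, hu, hub⟩ := exists_lt_of_csInf_lt (hf t) hb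
    have : ∀ᶠ s : ℝ≥0 in 𝓝[≥] t, (s : ℝ) < f u :=
      (NNReal.continuous_coe.tendsto t).eventually_lt_const hu |>.filter_mono nhdsWithin_le_nhds
    filter_upwards [this] with s hs
    have hmem : u ∈ {u : ℝ≥0 | (s : ℝ) < f u} := hs
    exact (csInf_le (OrderBot.bddBelow _) hmem).trans_lt hub

variable {Ω : Type*} {m : MeasurableSpace Ω} {μ : Measure Ω} [IsProbabilityMeasure μ]
  {α : ℝ} {L : ℝ≥0 → Ω → ℝ}

/-- Markov's inequality for `exp (-L n)`, of mean `exp (-n)`, bounds the probability that `L` stays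
below `K` by `exp (K - n)` for every `n`. Hence the infimum defining the inverse almost surely never
takes its default value. -/
lemma IsStableSubordinator.ae_exists_lt (hL : IsStableSubordinator α L μ) :
    ∀ᵐ ω ∂μ, ∀ t : ℝ≥0, ∃ u, (t : ℝ) < L u ω := by
  have key : ∀ K : ℕ, ∀ᵐ ω ∂μ, ∃ n : ℕ, (K : ℝ) < L n ω := by
    intro K
    have hle : ∀ n : ℕ, μ.real {ω | ∀ n : ℕ, L n ω ≤ K} ≤ Real.exp K * Real.exp (-n) := by
      intro n
      have h1 := mul_meas_ge_le_integral_of_nonneg (ae_of_all μ fun ω ↦ (Real.exp_pos _).le)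
        (hL.laplace n 1).1 (Real.exp (-K))
      rw [(hL.laplace n 1).2] at h1
      have h2 : μ.real {ω | ∀ n : ℕ, L n ω ≤ K} ≤
          μ.real {ω | Real.exp (-K) ≤ Real.exp (-(((1 : ℝ≥0) : ℝ) * L n ω))} :=
        measureReal_mono fun ω hω ↦ by
          have := hω n
          simpa using this
      have h3 := mul_le_mul_of_nonneg_left (h2.trans (le_of_eq rfl)) (Real.exp_pos (-(K : ℝ))).le
      calc _ = Real.exp K * (Real.exp (-K) * μ.real {ω | ∀ n : ℕ, L n ω ≤ K}) := by
            rw [← mul_assoc, ← Real.exp_add]; simp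
        _ ≤ _ := by
            gcongr
            simpa using h3.trans h1
    have hlim : Tendsto (fun n : ℕ ↦ Real.exp K * Real.exp (-n)) atTop (𝓝 (Real.exp K * 0)) :=
      (Real.tendsto_exp_neg_atTop_nhds_zero.comp tendsto_natCast_atTop_atTop).const_mul _
    have h0 := ge_of_tendsto' hlim hle
    rw [mul_zero] at h0
    have : μ {ω | ∀ n : ℕ, L n ω ≤ K} = 0 :=
      (measureReal_eq_zero_iff).1 (le_antisymm h0 measureReal_nonneg)
    filter_upwards [measure_eq_zero_iff_ae_notMem.1 this] with ω hω
    simpa using hω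
  filter_upwards [ae_all_iff.2 key] with ω hω t
  obtain ⟨K, hK⟩ := exists_nat_ge (t : ℝ)
  obtain ⟨n, hn⟩ := hω K
  exact ⟨n, hK.trans_lt hn⟩

/-- Here the Laplace variable `n` tends to infinity at a fixed time; `α > 0` makes the bound `exp
(-u n ^ α)` vanish. -/
lemma IsStableSubordinator.ae_pos (hL : IsStableSubordinator α L μ) (hα : 0 < α)
    {u : ℝ≥0} (hu : 0 < u) : ∀ᵐ ω ∂μ, 0 < L u ω := by
  have hle : ∀ n : ℕ, μ.real {ω | L u ω ≤ 0} ≤ Real.exp (-(u * (n : ℝ) ^ α)) := by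
    intro n
    have h1 := mul_meas_ge_le_integral_of_nonneg (ae_of_all μ fun ω ↦ (Real.exp_pos _).le)
      (hL.laplace u n).1 1
    rw [(hL.laplace u n).2, one_mul] at h1
    refine (measureReal_mono fun ω hω ↦ ?_).trans h1
    have hω' : L u ω ≤ 0 := hω
    exact Real.one_le_exp (neg_nonneg.2 (mul_nonpos_of_nonneg_of_nonpos (by positivity) hω'))
  have hlim : Tendsto (fun n : ℕ ↦ Real.exp (-(u * (n : ℝ) ^ α))) atTop (𝓝 0) :=
    Real.tendsto_exp_neg_atTop_nhds_zero.comp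
      (((tendsto_rpow_atTop hα).comp tendsto_natCast_atTop_atTop).const_mul_atTop
        (NNReal.coe_pos.2 hu))
  have : μ {ω | L u ω ≤ 0} = 0 :=
    (measureReal_eq_zero_iff).1 (le_antisymm (ge_of_tendsto' hlim hle) measureReal_nonneg)
  filter_upwards [measure_eq_zero_iff_ae_notMem.1 this] with ω hω
  simpa using hω

lemma IsStableSubordinator.ae_inverseProcess (hL : IsStableSubordinator α L μ) (hα : 0 < α) :
    ∀ᵐ ω ∂μ, inverseProcess L 0 ω = 0 ∧ Monotone (fun t ↦ inverseProcess L t ω) ∧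
      IsRightCts (fun t ↦ inverseProcess L t ω) := by
  -- Countably many times decreasing to `0` suffice to force the inverse at `0` to be `0`.
  have hpos : ∀ᵐ ω ∂μ, ∀ n : ℕ, 0 < L ((n : ℝ≥0) + 1)⁻¹ ω :=
    ae_all_iff.2 fun n ↦ hL.ae_pos hα (by positivity)
  filter_upwards [hL.ae_exists_lt, hpos] with ω hω hp
  refine ⟨?_, monotone_sInf_lt hω, isRightCts_sInf_lt hω⟩
  refine le_antisymm (le_of_forall_pos_le_add fun ε hε ↦ ?_) zero_le
  obtain ⟨n, hn⟩ := exists_nat_gt ε⁻¹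
  refine (csInf_le (OrderBot.bddBelow _) (show ((n : ℝ≥0) + 1)⁻¹ ∈ _ from ?_)).trans ?_
  · simpa using hp n
  · rw [zero_add]
    exact inv_le_of_inv_le₀ hε (hn.le.trans (by simp))

end Inverse

/-! ### Independence of past values and future increments. -/

section Independence

variable {Ω : Type*} {m : MeasurableSpace Ω} {μ : Measure Ω}

/-- A nondecreasing process in `ℕ` with independent increments and `N 0 = 0`: its past values are
jointly independent of its future increments. -/
lemma indepFun_past_increments {N : ℝ≥0 → Ω → ℕ} (hpt : IsPointProcess N μ)
    (hN : HasIndepIncrements N μ) {ι : Type*} [Finite ι] (s : ι → ℝ≥0) {n : ℕ}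
    {τ : Fin (n + 1) → ℝ≥0} (hτ : Monotone τ) (hs : ∀ j, s j ≤ τ 0) :
    IndepFun (fun ω j ↦ N (s j) ω)
      (fun ω (i : Fin n) ↦ N (τ i.succ) ω - N (τ i.castSucc) ω) μ := by
  classical
  have := Fintype.ofFinite ι
  -- The time `0` is added so that each past value is a sum of increments starting from `N 0 = 0`.
  let S : Finset ℝ≥0 := insert 0 (Finset.univ.image s)
  let p := S.card
  let e : Fin p ↪o ℝ≥0 := S.orderEmbOfFin rfl
  have he : ∀ i, e i ≤ τ 0 := fun i ↦ by
    have hi : e i ∈ S := S.orderEmbOfFin_mem rfl i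
    simp only [S, Finset.mem_insert, Finset.mem_image, Finset.mem_univ, true_and] at hi
    obtain h | ⟨j, hj⟩ := hi
    · simp [h]
    · exact hj ▸ hs j
  -- The sorted past times followed by `τ`, frozen at its last value. Increment `p - 1` bridges the
  -- two blocks; those with indices in `[p, p + n)` are the increments of `τ`.
  let u : ℕ → ℝ≥0 := fun k ↦ if h : k < p then e ⟨k, h⟩ else τ ⟨min (k - p) n, by omega⟩
  have hu : Monotone u := by
    intro a b hab
    by_cases ha : a < p <;> by_cases hb : b < p
    · simp only [u, ha, hb, dif_pos]
      exact e.monotone hab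
    · simp only [u, ha, hb, dif_pos, dif_neg, not_false_iff]
      exact (he _).trans (hτ (Fin.zero_le _))
    · omega
    · simp only [u, ha, hb, dif_neg, not_false_iff]
      exact hτ (Fin.mk_le_mk.2 (by omega))
  have hp : 0 < p := Finset.card_pos.2 ⟨0, by simp [S]⟩
  have hu0 : u 0 = 0 := by
    have h0 : (0 : ℝ≥0) ∈ Set.range e := by
      rw [S.range_orderEmbOfFin rfl]; simp [S]
    obtain ⟨i, hi⟩ := h0
    have h1 : u 0 = e ⟨0, hp⟩ := by simp [u, hp]
    rw [h1]
    refine le_antisymm ?_ zero_le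
    rw [← hi]
    exact e.monotone (Fin.mk_le_mk.2 (Nat.zero_le _))
  have hidx : ∀ j, ∃ k : Fin p, u k = s j := fun j ↦ by
    have h0 : s j ∈ Set.range e := by
      rw [S.range_orderEmbOfFin rfl]; simp [S]
    obtain ⟨i, hi⟩ := h0
    exact ⟨i, by simp [u, hi]⟩
  choose k hk using hidx
  have hmeas : ∀ i, Measurable fun ω ↦ N (u (i + 1)) ω - N (u i) ω :=
    fun i ↦ (hpt.measurable _).sub (hpt.measurable _)
  have hI := (hN.nat hu).indepFun_finset (Finset.range p) (Finset.Ico p (p + n))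
    (by
      rw [Finset.disjoint_left]
      intro a ha hb
      simp only [Finset.mem_range, Finset.mem_Ico] at ha hb
      omega) hmeas
  have hI' := hI.comp
    (φ := fun (g : Finset.range p → ℕ) (j : ι) ↦
      ∑ i : Fin (k j), g ⟨i, Finset.mem_range.2 (i.2.trans (k j).2)⟩)
    (ψ := fun (g : Finset.Ico p (p + n) → ℕ) (i : Fin n) ↦
      g ⟨p + i, Finset.mem_Ico.2 ⟨by omega, by omega⟩⟩)
    (measurable_pi_lambda _ fun j ↦ Finset.measurable_sum _ fun i _ ↦ measurable_pi_apply _)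
    (measurable_pi_lambda _ fun i ↦ measurable_pi_apply _)
  refine hI'.congr ?_ (ae_of_all _ fun ω ↦ ?_)
  -- Subtraction in `ℕ` is truncated, so the telescoping requires a nondecreasing path and holds
  -- only almost surely.
  · filter_upwards [hpt.paths] with ω hω
    funext j
    simp only [Function.comp]
    rw [Fin.sum_univ_eq_sum_range (fun i ↦ N (u (i + 1)) ω - N (u i) ω) (k j),
      Finset.sum_range_tsub (f := fun i ↦ N (u i) ω) (hω.2.1.comp hu), hu0, hω.1, hk]
    rfl
  · funext i
    have h1 : u (p + i + 1) = τ i.succ := by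
      have : ¬ (p + i + 1 < p) := by omega
      simp only [u, this, dif_neg, not_false_iff]
      congr 1
      ext
      simp
      omega
    have h2 : u (p + i) = τ i.castSucc := by
      have : ¬ (p + i < p) := by omega
      simp only [u, this, dif_neg, not_false_iff]
      congr 1
      ext
      simp
    simp only [Function.comp, h1, h2]

end Independence

/-! ### Jointly measurable evaluation of paths. -/

section Evaluation

/-- Evaluation of a path immediately to the right of a point, as a limit along the grids of
mesh `1 / (n + 1)`. On right-continuous paths it is the evaluation. -/
noncomputable def rightEval (v : ℝ≥0) (x : ℝ≥0 → ℕ) : ℕ :=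
  liminf (fun n : ℕ ↦ x (((⌊(n + 1) * v⌋₊ + 1 : ℕ) : ℝ≥0) / (n + 1))) atTop

/-- Plain evaluation `(v, x) ↦ x v` is not measurable for the product σ-algebra on paths, as it
involves uncountably many coordinates. Each grid point takes only countably many values as `v`
varies. -/
lemma measurable_rightEval : Measurable fun p : ℝ≥0 × (ℝ≥0 → ℕ) ↦ rightEval p.1 p.2 := by
  refine Measurable.liminf fun n ↦ ?_
  have h1 : Measurable fun q : ℕ × (ℝ≥0 → ℕ) ↦ q.2 (((q.1 + 1 : ℕ) : ℝ≥0) / (n + 1)) :=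
    measurable_from_prod_countable_right fun k ↦
      measurable_pi_apply (((k + 1 : ℕ) : ℝ≥0) / ((n : ℝ≥0) + 1))
  have h2 : Measurable fun p : ℝ≥0 × (ℝ≥0 → ℕ) ↦ (⌊((n : ℝ≥0) + 1) * p.1⌋₊, p.2) :=
    (Nat.measurable_floor.comp (measurable_fst.const_mul _)).prodMk measurable_snd
  exact h1.comp h2

lemma rightEval_eq {x : ℝ≥0 → ℕ} (hx : IsRightCts x) (v : ℝ≥0) : rightEval v x = x v := by
  -- The `+ 1` after the floor keeps the grid points to the right of `v`, where right-continuity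
  -- applies.
  have hbd : ∀ n : ℕ, v ≤ ((⌊((n : ℝ≥0) + 1) * v⌋₊ + 1 : ℕ) : ℝ≥0) / (n + 1) := fun n ↦ by
    rw [le_div_iff₀ (by positivity), mul_comm]
    exact_mod_cast (Nat.lt_floor_add_one _).le
  have hbd' : ∀ n : ℕ, ((⌊((n : ℝ≥0) + 1) * v⌋₊ + 1 : ℕ) : ℝ≥0) / (n + 1) ≤
      v + 1 / ((n : ℝ≥0) + 1) := fun n ↦ by
    rw [Nat.cast_add, add_div, Nat.cast_one]
    gcongr
    rw [div_le_iff₀ (by positivity), mul_comm]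
    exact Nat.floor_le zero_le
  have hlim : Tendsto (fun n : ℕ ↦ ((⌊((n : ℝ≥0) + 1) * v⌋₊ + 1 : ℕ) : ℝ≥0) / (n + 1)) atTop
      (𝓝[≥] v) := by
    refine tendsto_nhdsWithin_iff.2 ⟨?_, Eventually.of_forall hbd⟩
    refine tendsto_of_tendsto_of_tendsto_of_le_of_le tendsto_const_nhds ?_ hbd hbd'
    have : Tendsto (fun n : ℕ ↦ 1 / ((n : ℝ≥0) + 1)) atTop (𝓝 0) :=
      tendsto_one_div_add_atTop_nhds_zero_nat
    simpa using this.const_add v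
  exact ((hx v).tendsto.comp hlim).liminf_eq

end Evaluation

/-! ### Uniqueness of measures on a join of σ-algebras. -/

section SupSpace

variable {Ω : Type*}

/-- Two finite measures agree on `W ⊔ ⨆ i, κ i` if they agree on finite intersections of sets
from the generating σ-algebras. -/
lemma measure_eq_of_eq_on_inter {ι : Type*} {W : MeasurableSpace Ω} {κ : ι → MeasurableSpace Ω}
    {m : MeasurableSpace Ω} (hW : W ≤ m) (hκ : ∀ i, κ i ≤ m)
    {μ ν : Measure Ω} [IsFiniteMeasure μ] [IsFiniteMeasure ν]
    (h : ∀ C, MeasurableSet[W] C → ∀ (T : Finset ι) (D : ι → Set Ω),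
      (∀ i ∈ T, MeasurableSet[κ i] (D i)) → μ (C ∩ ⋂ i ∈ T, D i) = ν (C ∩ ⋂ i ∈ T, D i))
    {B : Set Ω} (hB : MeasurableSet[W ⊔ ⨆ i, κ i] B) : μ B = ν B := by
  classical
  have hle : W ⊔ ⨆ i, κ i ≤ m := sup_le hW (iSup_le hκ)
  -- The index `none` carries `W`, making `W` and the `κ i` a single family.
  let F : Option ι → MeasurableSpace Ω := fun o ↦ o.elim W κ
  have hgen : W ⊔ ⨆ i, κ i =
      MeasurableSpace.generateFrom (piiUnionInter (fun o ↦ {s | MeasurableSet[F o] s}) univ) := by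
    rw [generateFrom_piiUnionInter_measurableSet F univ]
    simp [F, iSup_option]
  have hpi : IsPiSystem (piiUnionInter (fun o ↦ {s | MeasurableSet[F o] s}) univ) :=
    isPiSystem_piiUnionInter _ (fun o ↦ @MeasurableSpace.isPiSystem_measurableSet _ (F o)) _
  rw [← trim_measurableSet_eq (μ := μ) hle hB, ← trim_measurableSet_eq (μ := ν) hle hB]
  congr 1
  refine ext_of_generate_finite _ hgen hpi ?_ ?_
  · rintro s hs
    have hs' : MeasurableSet[W ⊔ ⨆ i, κ i] s := by
      rw [hgen]; exact MeasurableSpace.measurableSet_generateFrom hs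
    rw [trim_measurableSet_eq hle hs', trim_measurableSet_eq hle hs']
    obtain ⟨T, -, f, hf, rfl⟩ := hs
    have heq : ⋂ o ∈ T, f o =
        (if none ∈ T then f none else univ) ∩ ⋂ i ∈ T.eraseNone, f (some i) := by
      ext ω
      simp only [mem_iInter, mem_inter_iff, Finset.mem_eraseNone]
      constructor
      · intro hω
        refine ⟨?_, fun i hi ↦ hω _ hi⟩
        split_ifs with hn
        · exact hω _ hn
        · trivial
      · rintro ⟨h1, h2⟩ (_ | i) hi
        · simpa [hi] using h1
        · exact h2 i hi
    rw [heq]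
    refine h _ ?_ _ _ fun i hi ↦ hf (some i) (Finset.mem_eraseNone.1 hi)
    split_ifs with hn
    · exact hf none hn
    · exact MeasurableSet.univ
  · rw [trim_measurableSet_eq hle MeasurableSet.univ, trim_measurableSet_eq hle MeasurableSet.univ]
    simpa using h univ MeasurableSet.univ ∅ (fun _ ↦ univ) (by simp)

end SupSpace

/-! ### Poisson processes run along an independent clock. -/

section TimeChange

variable {Ω : Type*} {m : MeasurableSpace Ω} {μ : Measure Ω}

lemma measurable_poissonMeasure_singleton (k : ℕ) :
    Measurable fun r : ℝ≥0 ↦ poissonMeasure r {k} := by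
  simp_rw [poissonMeasure_singleton]
  fun_prop

/-- A Poisson process with deterministic intensity `dΛ`. -/
structure IsInhomogeneousPoisson (N : ℝ≥0 → Ω → ℕ) (Λ : ℝ≥0 → ℝ≥0) (μ : Measure Ω) : Prop where
  isPointProcess : IsPointProcess N μ
  indep : HasIndepIncrements N μ
  law : ∀ s t, s ≤ t → HasLaw (fun ω ↦ N t ω - N s ω) (poissonMeasure (Λ t - Λ s)) μ

lemma IsPoissonProcess.isInhomogeneousPoisson_nonhomogeneous {N₁ : ℝ≥0 → Ω → ℕ}
    (hN₁ : IsPoissonProcess N₁ 1 μ) {lam : ℝ → ℝ} (hmono : Monotone (cumulativeRate lam))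
    (hcont : Continuous (cumulativeRate lam)) :
    IsInhomogeneousPoisson (nonhomogeneous lam N₁) (cumulativeRate lam) μ where
  isPointProcess :=
    { measurable := fun t ↦ hN₁.isPointProcess.measurable _
      paths := by
        filter_upwards [hN₁.isPointProcess.paths] with ω hω
        refine ⟨?_, hω.2.1.comp hmono,
          hω.2.2.comp (fun t ↦ hcont.continuousWithinAt) hmono⟩
        rw [nonhomogeneous, cumulativeRate_zero]
        exact hω.1 }
  indep := fun n t ht ↦ hN₁.indep n _ (hmono.comp ht)
  law := fun s t hst ↦ by
    simpa [nonhomogeneous] using hN₁.law _ _ (hmono hst)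

variable {N : ℝ≥0 → Ω → ℕ} {Λ : ℝ≥0 → ℝ≥0}

lemma IsInhomogeneousPoisson.measure_past_inter_increments (hN : IsInhomogeneousPoisson N Λ μ)
    {ι : Type*} [Finite ι] (s : ι → ℝ≥0) {n : ℕ} {τ : Fin (n + 1) → ℝ≥0} (hτ : Monotone τ)
    (hs : ∀ j, s j ≤ τ 0) (B : ι → Set ℕ) (k : Fin n → ℕ) :
    μ ({ω | ∀ j, N (s j) ω ∈ B j} ∩ {ω | ∀ i : Fin n, N (τ i.succ) ω - N (τ i.castSucc) ω = k i}) =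
      (∏ i : Fin n, poissonMeasure (Λ (τ i.succ) - Λ (τ i.castSucc)) {k i}) *
        μ {ω | ∀ j, N (s j) ω ∈ B j} := by
  have h1 := (indepFun_past_increments hN.isPointProcess hN.indep s hτ
    hs).measure_inter_preimage_eq_mul (univ.pi B) {k}
    (MeasurableSet.pi (to_countable _) fun _ _ ↦ .of_discrete)
    (measurableSet_singleton k)
  have h2 : μ {ω | ∀ i : Fin n, N (τ i.succ) ω - N (τ i.castSucc) ω = k i} =
      ∏ i : Fin n, poissonMeasure (Λ (τ i.succ) - Λ (τ i.castSucc)) {k i} := by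
    have h3 := (hN.indep n τ hτ).meas_iInter
      (s := fun i ↦ (fun ω ↦ N (τ i.succ) ω - N (τ i.castSucc) ω) ⁻¹' {k i})
      fun i ↦ ⟨{k i}, measurableSet_singleton _, rfl⟩
    refine Eq.trans (congrArg μ (by ext; simp)) (h3.trans ?_)
    refine Finset.prod_congr rfl fun i _ ↦ ?_
    have hl := hN.law _ _ (hτ (Fin.castSucc_lt_succ (i := i)).le)
    rw [← hl.map_eq, Measure.map_apply_of_aemeasurable hl.aemeasurable (measurableSet_singleton _)]
  rw [← h2, mul_comm]
  convert h1 using 2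
  · congr 1
    · ext ω; simp
    · ext ω; simp [funext_iff]
  · congr 1
    ext ω; simp
  · congr 1
    ext ω; simp [funext_iff]

variable [IsProbabilityMeasure μ]

/-- Fubini for a pair of independent random variables, in the form of a disintegration of the
probability of `E` over `A` along the first of them. -/
lemma measure_preimage_inter_of_indepFun {P X : Type*} [MeasurableSpace P] [MeasurableSpace X]
    {U : Ω → P} {V : Ω → X} (hU : Measurable U) (hV : Measurable V) (hind : IndepFun U V μ)
    {A E : Set (P × X)} (hA : MeasurableSet A) (hE : MeasurableSet E) {q : P → ℝ≥0∞}
    (hq : Measurable q) (h : ∀ᵐ y ∂μ.map U,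
      μ (V ⁻¹' (Prod.mk y ⁻¹' (A ∩ E))) = q y * μ (V ⁻¹' (Prod.mk y ⁻¹' A))) :
    μ ((fun ω ↦ (U ω, V ω)) ⁻¹' (A ∩ E)) =
      ∫⁻ ω in (fun ω ↦ (U ω, V ω)) ⁻¹' A, q (U ω) ∂μ := by
  have hpair : Measurable fun ω ↦ (U ω, V ω) := hU.prodMk hV
  have hlaw := hind.map_prod_eq_prod_map_map hU.aemeasurable hV.aemeasurable
  have hqA : Measurable (A.indicator fun p ↦ q p.1) := (hq.comp measurable_fst).indicator hA
  have hR : ∫⁻ ω in (fun ω ↦ (U ω, V ω)) ⁻¹' A, q (U ω) ∂μ =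
      ∫⁻ ω, A.indicator (fun p ↦ q p.1) (U ω, V ω) ∂μ := by
    rw [← lintegral_indicator (hpair hA)]
    rfl
  have hRy : ∀ y, ∫⁻ x, A.indicator (fun p ↦ q p.1) (y, x) ∂μ.map V =
      q y * μ.map V (Prod.mk y ⁻¹' A) := fun y ↦
    (lintegral_indicator_const (measurable_prodMk_left hA) (q y))
  rw [hR, ← lintegral_map hqA hpair, ← Measure.map_apply hpair (hA.inter hE), hlaw,
    Measure.prod_apply (hA.inter hE), lintegral_prod _ hqA.aemeasurable]
  refine lintegral_congr_ae ?_
  filter_upwards [h] with y hy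
  rw [hRy, Measure.map_apply hV (measurable_prodMk_left hA),
    Measure.map_apply hV (measurable_prodMk_left (hA.inter hE)), hy]

variable {Y : ℝ≥0 → Ω → ℝ≥0}

/-- The law of a Poisson process run along an independent random clock, on cylinder events. -/
lemma IsInhomogeneousPoisson.measure_timeChange_inter (hN : IsInhomogeneousPoisson N Λ μ)
    (hΛ : Measurable Λ) (hY : ∀ t, Measurable (Y t)) (hYmono : ∀ᵐ ω ∂μ, Monotone (fun t ↦ Y t ω))
    (hind : IndepFun (fun ω t ↦ Y t ω) (fun ω t ↦ N t ω) μ)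
    {C : Set (ℝ≥0 → ℝ≥0)} (hC : MeasurableSet C) {ι : Type*} [Finite ι] (s : ι → ℝ≥0) {n : ℕ}
    {t : Fin (n + 1) → ℝ≥0} (ht : Monotone t) (hs : ∀ j, s j ≤ t 0) (B : ι → Set ℕ)
    (k : Fin n → ℕ) :
    μ (((fun ω t ↦ Y t ω) ⁻¹' C ∩ {ω | ∀ j, N (Y (s j) ω) ω ∈ B j}) ∩
        {ω | ∀ i : Fin n, N (Y (t i.succ) ω) ω - N (Y (t i.castSucc) ω) ω = k i}) =
      ∫⁻ ω in (fun ω t ↦ Y t ω) ⁻¹' C ∩ {ω | ∀ j, N (Y (s j) ω) ω ∈ B j},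
        ∏ i : Fin n, poissonMeasure (Λ (Y (t i.succ) ω) - Λ (Y (t i.castSucc) ω)) {k i} ∂μ := by
  have hYY : Measurable fun ω t ↦ Y t ω := measurable_pi_lambda _ hY
  have hNN : Measurable fun ω t ↦ N t ω := measurable_pi_lambda _ hN.isPointProcess.measurable
  have hΦ : ∀ a : ℝ≥0, Measurable fun p : (ℝ≥0 → ℝ≥0) × (ℝ≥0 → ℕ) ↦ rightEval (p.1 a) p.2 :=
    fun a ↦ by
      have h : Measurable fun p : (ℝ≥0 → ℝ≥0) × (ℝ≥0 → ℕ) ↦ (p.1 a, p.2) := by fun_prop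
      exact measurable_rightEval.comp h
  have hA : MeasurableSet (Prod.fst ⁻¹' C ∩ ⋂ j, (fun p : (ℝ≥0 → ℝ≥0) × (ℝ≥0 → ℕ) ↦
      rightEval (p.1 (s j)) p.2) ⁻¹' B j) :=
    (measurable_fst hC).inter (MeasurableSet.iInter fun j ↦ hΦ _ .of_discrete)
  have hE : MeasurableSet (⋂ i, (fun p : (ℝ≥0 → ℝ≥0) × (ℝ≥0 → ℕ) ↦
      rightEval (p.1 (t (Fin.succ i))) p.2 - rightEval (p.1 (t i.castSucc)) p.2) ⁻¹' {k i}) :=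
    MeasurableSet.iInter fun i ↦ ((hΦ _).sub (hΦ _)) .of_discrete
  have hq : Measurable fun y : ℝ≥0 → ℝ≥0 ↦
      ∏ i : Fin n, poissonMeasure (Λ (y (t i.succ)) - Λ (y (t i.castSucc))) {k i} :=
    Finset.measurable_fun_prod _ fun i _ ↦ (measurable_poissonMeasure_singleton (k i)).comp
      ((hΛ.comp (measurable_pi_apply (t i.succ))).sub
        (hΛ.comp (measurable_pi_apply (t i.castSucc))))
  have hcts : ∀ᵐ ω ∂μ, ∀ v, rightEval v (fun t ↦ N t ω) = N v ω := by
    filter_upwards [hN.isPointProcess.paths] with ω hω v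
    exact rightEval_eq hω.2.2 v
  -- Order is transferred to the law of the clock one pair of times at a time: the set of all
  -- monotone paths is not measurable in the product σ-algebra.
  have hle : ∀ a b, a ≤ b → ∀ᵐ y ∂μ.map (fun ω t ↦ Y t ω), y a ≤ y b := fun a b hab ↦ by
    rw [ae_map_iff hYY.aemeasurable
      (measurableSet_le (measurable_pi_apply a) (measurable_pi_apply b))]
    filter_upwards [hYmono] with ω hω using hω hab
  have key := measure_preimage_inter_of_indepFun hYY hNN hind hA hE hq ?_
  · refine Eq.trans (measure_congr ?_) (key.trans (setLIntegral_congr ?_))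
    · refine eventuallyEq_set.2 ?_
      filter_upwards [hcts] with ω hω
      simp [hω]
    · refine eventuallyEq_set.2 ?_
      filter_upwards [hcts] with ω hω
      simp [hω]
  filter_upwards [ae_all_iff.2 fun j ↦ hle _ _ (hs j), ae_all_iff.2 fun i : Fin n ↦
    hle _ _ (ht (Fin.castSucc_lt_succ (i := i)).le)] with y hy1 hy2
  -- With `y` fixed, its values are deterministic times; outside `C` both sides vanish.
  by_cases hyC : y ∈ C
  · have h1 := hN.measure_past_inter_increments (fun j ↦ y (s j)) (τ := fun i ↦ y (t i))
      (Fin.monotone_iff_le_succ.2 hy2) hy1 B k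
    refine Eq.trans (measure_congr ?_) (h1.trans (congrArg _ (measure_congr ?_)))
    · refine eventuallyEq_set.2 ?_
      filter_upwards [hcts] with ω hω
      simp [hω, hyC]
    · refine eventuallyEq_set.2 ?_
      filter_upwards [hcts] with ω hω
      simp [hω, hyC]
  · have h1 : Prod.mk y ⁻¹' (Prod.fst ⁻¹' C ∩ ⋂ j, (fun p : (ℝ≥0 → ℝ≥0) × (ℝ≥0 → ℕ) ↦
        rightEval (p.1 (s j)) p.2) ⁻¹' B j) = ∅ := by ext x; simp [hyC]
    rw [preimage_inter, h1]
    simp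

end TimeChange

/-! ### From cylinder identities to conditional laws. -/

section Conditional

lemma condExp_indicator_eq_toReal {Ω : Type*} {G m : MeasurableSpace Ω} {μ : Measure Ω}
    [IsProbabilityMeasure μ] (hG : G ≤ m) {E : Set Ω} (hE : MeasurableSet E) {q : Ω → ℝ≥0∞}
    (hq : Measurable[G] q) (hq1 : ∀ ω, q ω ≤ 1)
    (h : ∀ B, MeasurableSet[G] B → μ (B ∩ E) = ∫⁻ ω in B, q ω ∂μ) :
    μ⟦E | G⟧ =ᵐ[μ] fun ω ↦ (q ω).toReal := by
  have hqm : Measurable q := hq.mono hG le_rfl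
  have hint : Integrable (fun ω ↦ (q ω).toReal) μ :=
    integrable_toReal_of_lintegral_ne_top hqm.aemeasurable
      (ne_top_of_le_ne_top (by simp) (lintegral_mono hq1))
  refine (ae_eq_condExp_of_forall_setIntegral_eq hG ((integrable_const 1).indicator hE)
    (fun s _ _ ↦ hint.integrableOn) (fun s hs _ ↦ ?_)
    hq.ennreal_toReal.aestronglyMeasurable).symm
  rw [integral_toReal hqm.aemeasurable
    (ae_of_all _ fun ω ↦ (hq1 ω).trans_lt ENNReal.one_lt_top), ← h s hs,
    setIntegral_indicator hE, setIntegral_const]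
  simp [measureReal_def]

variable {Ω : Type*}

/-- The joint conditional law of the increments determines a conditional Poisson process. -/
lemma IsConditionallyPoisson.of_joint {G : MeasurableSpace Ω} {m : MeasurableSpace Ω}
    {μ : Measure Ω} {r : ℝ≥0} {N : ℝ≥0 → Ω → ℕ} {A : ℝ≥0 → Ω → ℝ≥0}
    (h : ∀ (n : ℕ) (t : Fin (n + 1) → ℝ≥0), r ≤ t 0 → Monotone t → ∀ k : Fin n → ℕ,
      μ⟦{ω | ∀ i : Fin n, N (t i.succ) ω - N (t i.castSucc) ω = k i} | G⟧ =ᵐ[μ]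
        fun ω ↦ ∏ i : Fin n, (poissonMeasure (A (t i.succ) ω - A (t i.castSucc) ω)).real {k i}) :
    IsConditionallyPoisson G r N A μ := by
  have hlaw : ∀ s t, r ≤ s → s ≤ t → ∀ k : ℕ,
      μ⟦{ω | N t ω - N s ω = k} | G⟧ =ᵐ[μ] fun ω ↦ (poissonMeasure (A t ω - A s ω)).real {k} := by
    intro s t hs hst k
    have h1 := h 1 ![s, t] hs (by
      refine Fin.monotone_iff_le_succ.2 fun i ↦ ?_
      fin_cases i
      exact hst) fun _ ↦ k
    simpa using h1
  refine ⟨hlaw, fun n t hr ht k ↦ (h n t hr ht k).trans ?_⟩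
  have h2 : ∀ᵐ ω ∂μ, ∀ i : Fin n,
      (μ⟦{ω' | N (t i.succ) ω' - N (t i.castSucc) ω' = k i} | G⟧) ω =
        (poissonMeasure (A (t i.succ) ω - A (t i.castSucc) ω)).real {k i} :=
    ae_all_iff.2 fun i ↦ hlaw _ _ (hr.trans (ht (Fin.zero_le _)))
      (ht (Fin.castSucc_lt_succ (i := i)).le) (k i)
  filter_upwards [h2] with ω hω
  exact Finset.prod_congr rfl fun i _ ↦ (hω i).symm

lemma wholeHistory_eq_comap (Z : ℝ≥0 → Ω → ℝ≥0) :
    wholeHistory Z = MeasurableSpace.comap (fun ω t ↦ Z t ω) MeasurableSpace.pi := by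
  simp only [MeasurableSpace.pi, MeasurableSpace.comap_iSup, MeasurableSpace.comap_comp]
  rfl

/-- A measurable embedding pulls the Borel σ-algebra back to the whole Borel σ-algebra, so no
information is lost. -/
lemma wholeHistory_comp {Λ : ℝ≥0 → ℝ≥0} (hΛ : MeasurableEmbedding Λ) (Z : ℝ≥0 → Ω → ℝ≥0) :
    wholeHistory (fun t ω ↦ Λ (Z t ω)) = wholeHistory Z := by
  refine iSup_congr fun t ↦ ?_
  conv_rhs => rw [← hΛ.comap_eq, MeasurableSpace.comap_comp]
  rfl

variable {m : MeasurableSpace Ω} {μ : Measure Ω} [IsProbabilityMeasure μ]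
  {N : ℝ≥0 → Ω → ℕ} {Λ : ℝ≥0 → ℝ≥0} {Y : ℝ≥0 → Ω → ℝ≥0}

lemma IsInhomogeneousPoisson.condExp_increments_timeChange (hN : IsInhomogeneousPoisson N Λ μ)
    (hΛ : Measurable Λ) (hY : ∀ t, Measurable (Y t)) (hYmono : ∀ᵐ ω ∂μ, Monotone (fun t ↦ Y t ω))
    (hind : IndepFun (fun ω t ↦ Y t ω) (fun ω t ↦ N t ω) μ)
    (hM : ∀ t, Measurable fun ω ↦ N (Y t ω) ω) (r : ℝ≥0) {n : ℕ} {t : Fin (n + 1) → ℝ≥0}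
    (hr : r ≤ t 0) (ht : Monotone t) (k : Fin n → ℕ) :
    μ⟦{ω | ∀ i : Fin n, N (Y (t i.succ) ω) ω - N (Y (t i.castSucc) ω) ω = k i} |
        wholeHistory Y ⊔ pastHistory (fun t ω ↦ N (Y t ω) ω) r⟧ =ᵐ[μ]
      fun ω ↦ ∏ i : Fin n,
        (poissonMeasure (Λ (Y (t i.succ) ω) - Λ (Y (t i.castSucc) ω))).real {k i} := by
  have hW : wholeHistory Y ≤ m := iSup_le fun t ↦ (hY t).comap_le
  have hP : pastHistory (fun t ω ↦ N (Y t ω) ω) r =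
      ⨆ s : {s // s ≤ r}, MeasurableSpace.comap (fun ω ↦ N (Y s ω) ω) inferInstance :=
    iSup_subtype'
  have hE : MeasurableSet
      {ω | ∀ i : Fin n, N (Y (t i.succ) ω) ω - N (Y (t i.castSucc) ω) ω = k i} := by
    simp only [ofPred_forall]
    exact MeasurableSet.iInter fun i ↦
      ((hM _).sub (hM _)) (measurableSet_singleton (k i))
  have hYW : ∀ a, Measurable[wholeHistory Y] (Y a) := fun a ↦
    measurable_iff_comap_le.2 (le_iSup (fun t ↦ MeasurableSpace.comap (Y t) inferInstance) a)
  have hq : Measurable[wholeHistory Y] fun ω ↦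
      ∏ i : Fin n, poissonMeasure (Λ (Y (t i.succ) ω) - Λ (Y (t i.castSucc) ω)) {k i} :=
    Finset.measurable_fun_prod _ fun i _ ↦ (measurable_poissonMeasure_singleton (k i)).comp
      ((hΛ.comp (hYW (t i.succ))).sub (hΛ.comp (hYW (t i.castSucc))))
  have hq1 : ∀ ω, ∏ i : Fin n,
      poissonMeasure (Λ (Y (t i.succ) ω) - Λ (Y (t i.castSucc) ω)) {k i} ≤ 1 :=
    fun ω ↦ by
      exact Finset.prod_le_one (fun i _ ↦ zero_le) fun i _ ↦
        prob_le_one (μ := poissonMeasure (Λ (Y (t i.succ) ω) - Λ (Y (t i.castSucc) ω)))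
  have hle : (wholeHistory Y ⊔ ⨆ s : {s // s ≤ r},
      MeasurableSpace.comap (fun ω ↦ N (Y s ω) ω) inferInstance) ≤ m :=
    sup_le hW (iSup_le fun s ↦ (hM s).comap_le)
  rw [hP]
  refine (condExp_indicator_eq_toReal (μ := μ) hle hE
    (hq.mono le_sup_left le_rfl) hq1 fun B hB ↦ ?_).trans (ae_of_all _ fun ω ↦ ?_)
  -- Both sides of the defining identity are finite measures of `B`: `μ` restricted to the increment
  -- event, and `μ` with the Poisson product as density. Cylinder events therefore suffice.
  · have hfin : IsFiniteMeasure (μ.withDensity fun ω ↦ ∏ i : Fin n,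
        poissonMeasure (Λ (Y (t i.succ) ω) - Λ (Y (t i.castSucc) ω)) {k i}) :=
      isFiniteMeasure_withDensity (ne_top_of_le_ne_top (by simp) (lintegral_mono hq1))
    have hBm : MeasurableSet B := hle B hB
    rw [← Measure.restrict_apply hBm, ← withDensity_apply _ hBm]
    refine measure_eq_of_eq_on_inter hW (ι := {s // s ≤ r}) (fun s ↦ (hM s).comap_le)
      (fun C hC T D hD ↦ ?_) hB
    have hmeas : MeasurableSet (C ∩ ⋂ i ∈ T, D i) :=
      (hW _ hC).inter (T.measurableSet_biInter fun i hi ↦ (hM i).comap_le _ (hD i hi))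
    rw [Measure.restrict_apply hmeas, withDensity_apply _ hmeas]
    rw [wholeHistory_eq_comap] at hC
    obtain ⟨C, hC, rfl⟩ := hC
    choose! D' hD' using hD
    have heq : ⋂ i ∈ T, D i = {ω | ∀ j : T, N (Y j.1.1 ω) ω ∈ D' j.1} := by
      ext ω
      simp only [mem_iInter, mem_ofPred_eq, Subtype.forall]
      refine forall_congr' fun s ↦ forall_congr' fun hs ↦ forall_congr' fun hi ↦ ?_
      rw [← (hD' _ hi).2]
      rfl
    rw [heq]
    exact hN.measure_timeChange_inter hΛ hY hYmono hind hC (fun j : T ↦ j.1.1) ht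
      (fun j ↦ j.1.2.trans hr) _ k
  · exact ENNReal.toReal_prod _ _

end Conditional

end FNPP

theorem mainTheorem5 {Ω : Type*} {m : MeasurableSpace Ω} (μ : Measure Ω) [IsProbabilityMeasure μ]
    (lam : ℝ → ℝ) (hlam_pos : ∀ τ : ℝ, 0 ≤ τ → 0 < lam τ)
    (hlam_int : LocallyIntegrableOn lam (Ici 0) volume)
    (hlam_top : Tendsto (FNPP.cumulativeRate lam) atTop atTop)
    (α : ℝ) (hα : α ∈ Ioo (0 : ℝ) 1)
    (N₁ : ℝ≥0 → Ω → ℕ) (hN₁ : FNPP.IsPoissonProcess N₁ 1 μ)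
    (L : ℝ≥0 → Ω → ℝ) (hL : FNPP.IsStableSubordinator α L μ)
    (hindep : IndepFun (fun ω t ↦ FNPP.inverseProcess L t ω)
      (fun ω t ↦ FNPP.nonhomogeneous lam N₁ t ω) μ)
    (hY : ∀ t, Measurable (FNPP.inverseProcess L t))
    (hNα : ∀ t, Measurable (FNPP.fractional lam N₁ L t)) :
    FNPP.IsCoxProcess
      (FNPP.intrinsicHistory (FNPP.inverseProcess L) (FNPP.fractional lam N₁ L) hY hNα)
      (FNPP.fractional lam N₁ L)
      (fun t ω ↦ FNPP.cumulativeRate lam (FNPP.inverseProcess L t ω)) μ := by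
  have hmono := FNPP.cumulativeRate_strictMono hlam_pos hlam_int
  have hcont := FNPP.continuous_cumulativeRate hlam_int
  have hN := hN₁.isInhomogeneousPoisson_nonhomogeneous hmono.monotone hcont
  have hYpaths := hL.ae_inverseProcess hα.1
  have hW := FNPP.wholeHistory_comp (hcont.measurableEmbedding hmono.injective)
    (FNPP.inverseProcess L)
  have hYW : ∀ a, Measurable[FNPP.wholeHistory (FNPP.inverseProcess L)]
      (FNPP.inverseProcess L a) := fun a ↦ measurable_iff_comap_le.2
    (le_iSup (fun t ↦ MeasurableSpace.comap (FNPP.inverseProcess L t) inferInstance) a)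
  have hjoint := fun (r : ℝ≥0) (n : ℕ) (t : Fin (n + 1) → ℝ≥0) (hr : r ≤ t 0) (ht : Monotone t)
      (k : Fin n → ℕ) ↦ hN.condExp_increments_timeChange hcont.measurable hY
    (hYpaths.mono fun ω hω ↦ hω.2.1) hindep hNα r hr ht k
  refine ⟨⟨hNα, ?_⟩, fun t ↦ ?_, ?_, fun t ↦ ?_, .of_joint fun n t hr ht k ↦ ?_, fun r ↦
    .of_joint (hjoint r)⟩
  · filter_upwards [hYpaths, hN.isPointProcess.paths] with ω hω hNω
    refine ⟨?_, hNω.2.1.comp hω.2.1, hNω.2.2.comp hω.2.2 hω.2.1⟩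
    rw [FNPP.fractional, hω.1]
    exact hNω.1
  · exact measurable_iff_comap_le.2 (le_sup_of_le_right (le_iSup₂_of_le t le_rfl le_rfl))
  · filter_upwards [hYpaths] with ω hω
    exact ⟨hmono.monotone.comp hω.2.1, fun t ↦ (hcont.tendsto _).comp (hω.2.2 t)⟩
  · rw [hW]
    rfl
  · rw [hW]
    have hF0 : FNPP.wholeHistory (FNPP.inverseProcess L) ⊔
        FNPP.pastHistory (FNPP.fractional lam N₁ L) 0 ≤ m :=
      (FNPP.intrinsicHistory _ _ hY hNα).le 0
    have hle : FNPP.wholeHistory (FNPP.inverseProcess L) ≤ m :=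
      iSup_le fun t ↦ (hY t).comap_le
    -- Tower property from the history at time `0`: the product of Poisson weights is already
    -- measurable for the clock, so conditioning down leaves it unchanged.
    refine (condExp_condExp_of_le (μ := μ) le_sup_left hF0).symm.trans
      ((condExp_congr_ae (hjoint 0 n t hr ht k)).trans ?_)
    refine (condExp_of_stronglyMeasurable hle ?_ ?_).eventuallyEq
    · refine Measurable.stronglyMeasurable (Finset.measurable_fun_prod _ fun i _ ↦ ?_)
      exact ((FNPP.measurable_poissonMeasure_singleton (k i)).comp
        ((hcont.measurable.comp (hYW (t i.succ))).sub
          (hcont.measurable.comp (hYW (t i.castSucc))))).ennreal_toReal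
    · exact integrable_condExp.congr (hjoint 0 n t hr ht k)
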